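/- For a finite-dimensional division algebra $D$ with center a field $K$, a maximal subfield of $D$ is a maximal element (under inclusion) of the set of fields $E$ with $K\subseteq E\subseteq D$. Two finite-dimensional division algebras with center $K$ are called weakly isomorphic if they have the same set of $K$-isomorphism classes of maximal subfields. The genus of $D$ is the set of $K$-isomorphism classes of finite-dimensional division algebras $D'$ with center $K$ that are weakly isomorphic to $D$. **Theorem A.** There exist a field $K$ of characteristic different from $2$ and a quaternion division algebra $D$ with center $K$ (that is, a division algebra of the form $D\cong\left(\frac{a,b}{K}\right)$ with $a,b\in K^\times$) whose genus is infinite. -/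

import Mathlib

universe u

/-- A (finite-dimensional) division algebra with center `k`. -/
structure CentralDivisionAlgebra (k : Type u) [Field k] where
  carrier : Type u
  [divisionRing : DivisionRing carrier]
  [algebra : Algebra k carrier]
  [isCentral : Algebra.IsCentral k carrier]
  [finiteDimensional : FiniteDimensional k carrier]

attribute [instance] CentralDivisionAlgebra.divisionRing CentralDivisionAlgebra.algebra
  CentralDivisionAlgebra.isCentral CentralDivisionAlgebra.finiteDimensional

/-- A field extension of `k`. -/
structure FieldExtension (k : Type u) [Field k] where
  carrier : Type u
  [commRing : CommRing carrier]
  [algebra : Algebra k carrier]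
  isField : IsField carrier

attribute [instance] FieldExtension.commRing FieldExtension.algebra

/-- Isomorphism of field extensions of `k`. -/
def FieldExtension.isoSetoid (k : Type u) [Field k] : Setoid (FieldExtension k) where
  r E E' := Nonempty (E.carrier ≃ₐ[k] E'.carrier)
  iseqv :=
    { refl := fun _ => ⟨AlgEquiv.refl⟩
      symm := fun ⟨e⟩ => ⟨e.symm⟩
      trans := fun ⟨e⟩ ⟨f⟩ => ⟨e.trans f⟩ }

/-- Isomorphism classes of field extensions of `k`. -/
def FieldExtension.IsoClass (k : Type u) [Field k] : Type (u + 1) :=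
  Quotient (FieldExtension.isoSetoid k)

/-- The isomorphism class of a field extension of `k`. -/
def FieldExtension.isoClass {k : Type u} [Field k] (E : FieldExtension k) :
    FieldExtension.IsoClass k :=
  Quotient.mk (FieldExtension.isoSetoid k) E

namespace CentralDivisionAlgebra

variable {k : Type u} [Field k]

/-- `E` is a subfield with `k ⊆ E ⊆ D`, and is maximal under inclusion among these. -/
def IsMaximalSubfield (D : CentralDivisionAlgebra k) (E : Subalgebra k D.carrier) : Prop :=
  Maximal (fun E' : Subalgebra k D.carrier => IsField E') E

/-- A subfield `k ⊆ E ⊆ D`, regarded as a field extension of `k`. -/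
def subfieldExtension (D : CentralDivisionAlgebra k) (E : Subalgebra k D.carrier)
    (hE : IsField E) : FieldExtension k :=
  letI : CommRing E := { (inferInstance : Ring E) with mul_comm := hE.mul_comm }
  { carrier := E
    isField := hE }

/-- The maximal subfield spectrum `Max(D)`: the set of isomorphism classes (over `k`) of
maximal subfields of `D`. -/
def maximalSubfieldSpectrum (D : CentralDivisionAlgebra k) : Set (FieldExtension.IsoClass k) :=
  {c | ∃ (E : Subalgebra k D.carrier) (hE : D.IsMaximalSubfield E),
    (D.subfieldExtension E hE.prop).isoClass = c}

/-- Two central division algebras over `k` are weakly isomorphic if they have the same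
maximal subfield spectrum. -/
def WeaklyIsomorphic (D D' : CentralDivisionAlgebra k) : Prop :=
  D.maximalSubfieldSpectrum = D'.maximalSubfieldSpectrum

/-- Isomorphism of `k`-algebras. -/
def isoSetoid (k : Type u) [Field k] : Setoid (CentralDivisionAlgebra k) where
  r D D' := Nonempty (D.carrier ≃ₐ[k] D'.carrier)
  iseqv :=
    { refl := fun _ => ⟨AlgEquiv.refl⟩
      symm := fun ⟨e⟩ => ⟨e.symm⟩
      trans := fun ⟨e⟩ ⟨f⟩ => ⟨e.trans f⟩ }

/-- Isomorphism classes of central division algebras over `k`. -/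
def IsoClass (k : Type u) [Field k] : Type (u + 1) :=
  Quotient (isoSetoid k)

/-- The isomorphism class of a central division algebra over `k`. -/
def isoClass (D : CentralDivisionAlgebra k) : IsoClass k :=
  Quotient.mk (isoSetoid k) D

/-- The genus of `D`: the set of isomorphism classes of central division algebras over `k`
that are weakly isomorphic to `D`. -/
def genus (D : CentralDivisionAlgebra k) : Set (IsoClass k) :=
  {c | ∃ D' : CentralDivisionAlgebra k, D.WeaklyIsomorphic D' ∧ D'.isoClass = c}

/-- For `k` of characteristic not `2`: `D` is a quaternion algebra, that is, it has the form
`(a, b / k)`, with basis `1, i, j, ij` and `i² = a`, `j² = b`, `ij = -ji`, where `a, b ∈ kˣ`. -/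
def IsQuaternion (D : CentralDivisionAlgebra k) : Prop :=
  ∃ a b : k, a ≠ 0 ∧ b ≠ 0 ∧ Nonempty (D.carrier ≃ₐ[k] QuaternionAlgebra k a 0 b)

end CentralDivisionAlgebra

/-!
Write `(-1, b)` for the quaternion algebra over a field `K ⊆ ℝ`. The square roots of `d` among its
pure quaternions are the solutions of `d = -x² + b y² + b z²`. Hence, if this equation is soluble
for every nonsquare `d` and every `b > 0`, all quadratic extensions of `K` embed into all the
algebras `(-1, b)`, and their maximal subfields coincide. On the other hand, `(-1, b) ≅ (-1, c)`
forces `b c` to be a sum of two squares in `K`.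

One forces the equation for given `b` and `d` to become soluble by passing to the function field
of the corresponding quadric. With `L = K(i)`, this amounts to adjoining to `L` a real
transcendental `x` and then a transcendental `t` such that `t * conj t = b (x² + d)`. Sums of two
squares in `K` are norms from `L`, and comparing the factorisations of both sides of a norm
equation, first in `L(x)[T, T⁻¹]` and then in `L[X]`, shows that no element of `K` newly becomes
a norm: it would have to be one up to a power of `b (x² + d)`, and an odd power is excluded by the
prime `X² + d`. Starting from `ℚ`, countably many such steps produce a field `K` over which all
the equations are soluble, while products of two distinct primes congruent to `3` modulo `4` are
still not sums of two squares.
-/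

open Polynomial
open scoped IntermediateField LaurentPolynomial ComplexConjugate Quaternion

section InvolutiveNorm

variable {R : Type*} [CommRing R] {s : R →+* R}

theorem exists_isUnit_mul_map_eq [IsDomain R] (hs : Function.Involutive s) {P Q v : R}
    (hPQ : IsCoprime P Q) (hQ : Q ≠ 0) (hv : IsUnit v) (h : P * s P = v * (Q * s Q)) :
    ∃ u, IsUnit u ∧ u * s u = v := by
  have hsQ : s Q ≠ 0 := (map_ne_zero_iff s hs.injective).mpr hQ
  have hPsQ : P ∣ s Q := hPQ.dvd_of_dvd_mul_left (hv.dvd_mul_left.mp (h ▸ dvd_mul_right P (s P)))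
  have hQsP : Q ∣ s P :=
    hPQ.symm.dvd_of_dvd_mul_left (h ▸ (dvd_mul_right Q (s Q)).mul_left v)
  obtain ⟨u, hu⟩ : s Q ∣ P := by simpa only [hs P] using map_dvd s hQsP
  have hu_unit : IsUnit u := isUnit_of_dvd_one <| by
    rwa [hu, ← mul_one (s Q), mul_assoc, mul_dvd_mul_iff_left hsQ, one_mul] at hPsQ
  refine ⟨u, hu_unit, mul_right_cancel₀ (mul_ne_zero hQ hsQ) ?_⟩
  rw [← h, hu, map_mul, hs Q]
  ring

theorem dvd_and_dvd_map_of_prime_dvd_mul_map (hs : Function.Involutive s) {π P : R} (hπ : Prime π)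
    (hsπ : s π = π) (h : π ∣ P * s P) : π ∣ P ∧ π ∣ s P := by
  have key {Q : R} (hQ : π ∣ Q) : π ∣ s Q := hsπ ▸ map_dvd s hQ
  rcases hπ.dvd_or_dvd h with hP | hP
  · exact ⟨hP, key hP⟩
  · exact ⟨hs P ▸ key hP, hP⟩

theorem mul_map_ne_prime_mul [IsDomain R] (hs : Function.Involutive s) {P Q π v : R}
    (hPQ : IsCoprime P Q) (hπ : Prime π) (hsπ : s π = π) (hv : IsUnit v) :
    P * s P ≠ v * π * (Q * s Q) := by
  intro h
  obtain ⟨hP, hsP⟩ := dvd_and_dvd_map_of_prime_dvd_mul_map hs hπ hsπ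
    (h ▸ (dvd_mul_left π v).mul_right (Q * s Q))
  have hQ : π ∣ Q * s Q := by
    rw [← mul_dvd_mul_iff_left hπ.ne_zero, ← hv.dvd_mul_left, ← mul_assoc, ← h]
    exact mul_dvd_mul hP hsP
  exact hπ.not_isUnit <|
    hPQ.isUnit_of_dvd' hP (dvd_and_dvd_map_of_prime_dvd_mul_map hs hπ hsπ hQ).1

variable {M : Type*} [Field M] {σ : M →+* M} {ι : R →+* M}

theorem mul_map_eq_of_div_mul_map_div_eq (hι : Function.Injective ι)
    (hσ : ∀ r, σ (ι r) = ι (s r)) {P Q v : R} (hQ : ι Q ≠ 0)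
    (h : ι P / ι Q * σ (ι P / ι Q) = ι v) : P * s P = v * (Q * s Q) := by
  have hsQ : ι (s Q) ≠ 0 := hσ Q ▸ (map_ne_zero σ).mpr hQ
  apply hι
  simp only [map_div₀, hσ, div_mul_div_comm] at h
  simpa only [map_mul] using (div_eq_iff (mul_ne_zero hQ hsQ)).mp h

end InvolutiveNorm

theorem exists_isCoprime_of_mem_adjoin_simple {L M : Type*} [Field L] [Field M] [Algebra L M]
    {x z : M} (hz : z ∈ L⟮x⟯) :
    ∃ P Q : L[X], IsCoprime P Q ∧ aeval x Q ≠ 0 ∧ z = aeval x P / aeval x Q := by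
  classical
  let _ := EuclideanDomain.gcdMonoid L[X]
  obtain ⟨p, q, rfl⟩ := (IntermediateField.mem_adjoin_simple_iff L z).mp hz
  by_cases hq : aeval x q = 0
  · exact ⟨0, 1, isCoprime_one_right, by simp, by simp [hq]⟩
  obtain ⟨P, Q, hp', hq', hPQ⟩ := extract_gcd p q
  rw [hq', map_mul] at hq
  refine ⟨P, Q, (gcd_isUnit_iff P Q).mp hPQ, right_ne_zero_of_mul hq, ?_⟩
  rw [congrArg (aeval x) hp', congrArg (aeval x) hq', map_mul, map_mul,
    mul_div_mul_left _ _ (left_ne_zero_of_mul hq)]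

/-- The value `w * σ w` is the norm of `w` to the fixed field of the involution `σ`; this predicate
singles out the norms of elements of the subfield `L`. -/
def IsInvolutionNorm {M : Type*} [Field M] (σ : M →+* M) (L : Subfield M) (a : M) : Prop :=
  ∃ w ∈ L, w * σ w = a

section SimpleTranscendental

variable {M : Type*} [Field M] {σ : M →+* M} {L : Subfield M} {a d x : M}

theorem IsInvolutionNorm.mul {b : M} (ha : IsInvolutionNorm σ L a) (hb : IsInvolutionNorm σ L b) :
    IsInvolutionNorm σ L (a * b) := by
  obtain ⟨v, hv, rfl⟩ := ha
  obtain ⟨w, hw, rfl⟩ := hb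
  exact ⟨v * w, mul_mem hv hw, by rw [map_mul]; ring⟩

theorem restrict_involutive (hσ : Function.Involutive σ) (hL : ∀ z ∈ L, σ z ∈ L) :
    Function.Involutive (σ.restrict L L hL) :=
  fun z => Subtype.ext (hσ z)

theorem aeval_mapRingHom_restrict (hL : ∀ z ∈ L, σ z ∈ L) (hx : σ x = x) (P : L[X]) :
    aeval x (mapRingHom (σ.restrict L L hL) P) = σ (aeval x P) := by
  simp only [coe_mapRingHom, aeval_def, eval₂_map, hom_eval₂, hx]
  rfl

theorem mapRingHom_involutive {R : Type*} [CommSemiring R] {τ : R →+* R}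
    (hτ : Function.Involutive τ) : Function.Involutive (mapRingHom τ) := fun P => by
  rw [coe_mapRingHom, Polynomial.map_map, RingHom.ext (f := τ.comp τ) (g := RingHom.id R) hτ,
    Polynomial.map_id]

theorem IsInvolutionNorm.of_adjoin_fixed (hσ : Function.Involutive σ) (hL : ∀ z ∈ L, σ z ∈ L)
    (hx : Transcendental L x) (hσx : σ x = x) (ha : a ∈ L) (ha0 : a ≠ 0)
    (h : IsInvolutionNorm σ L⟮x⟯.toSubfield a) : IsInvolutionNorm σ L a := by
  lift a to L using ha
  obtain ⟨z, hz, hza⟩ := h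
  obtain ⟨P, Q, hPQ, hQ, rfl⟩ := exists_isCoprime_of_mem_adjoin_simple hz
  have hnorm : P * mapRingHom (σ.restrict L L hL) P = C a * (Q * mapRingHom _ Q) :=
    mul_map_eq_of_div_mul_map_div_eq (ι := (aeval x : L[X] →ₐ[L] M).toRingHom)
      (transcendental_iff_injective.mp hx) (fun P => (aeval_mapRingHom_restrict hL hσx P).symm)
      hQ (hza.trans (aeval_C x a).symm)
  obtain ⟨u, hu, hua⟩ := exists_isUnit_mul_map_eq
    (mapRingHom_involutive (restrict_involutive hσ hL)) hPQ (by rintro rfl; simp at hQ)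
    (isUnit_C.mpr (IsUnit.mk0 a (by simpa using ha0))) hnorm
  obtain ⟨w, -, rfl⟩ := Polynomial.isUnit_iff.mp hu
  rw [coe_mapRingHom, map_C, ← C_mul, C_inj] at hua
  exact ⟨w, w.2, congrArg Subtype.val hua⟩

theorem prime_X_sq_add_C {F : Type*} [Field F] {d : F} (hd : ∀ z : F, z ^ 2 ≠ -d) :
    Prime (X ^ 2 + C d) := by
  rw [← sub_neg_eq_add, ← C_neg]
  exact ((X_pow_sub_C_irreducible_iff_of_prime Nat.prime_two).mpr hd).prime

theorem not_isInvolutionNorm_adjoin_fixed (hσ : Function.Involutive σ) (hL : ∀ z ∈ L, σ z ∈ L)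
    (hx : Transcendental L x) (hσx : σ x = x) (ha : a ∈ L) (ha0 : a ≠ 0) (hd : d ∈ L)
    (hσd : σ d = d) (hsq : ∀ z ∈ L, z ^ 2 ≠ -d) :
    ¬ IsInvolutionNorm σ L⟮x⟯.toSubfield (a * (x ^ 2 + d)) := by
  lift a to L using ha
  lift d to L using hd
  rintro ⟨z, hz, hza⟩
  obtain ⟨P, Q, hPQ, hQ, rfl⟩ := exists_isCoprime_of_mem_adjoin_simple hz
  have hσπ : mapRingHom (σ.restrict L L hL) (X ^ 2 + C d) = X ^ 2 + C d := by
    simp only [coe_mapRingHom, Polynomial.map_add, Polynomial.map_pow, map_X, map_C,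
      Subtype.ext (a1 := σ.restrict L L hL d) hσd]
  refine mul_map_ne_prime_mul (mapRingHom_involutive (restrict_involutive hσ hL)) hPQ
    (prime_X_sq_add_C fun z hz => hsq z z.2 (congrArg Subtype.val hz)) hσπ
    (isUnit_C.mpr (IsUnit.mk0 a (by simpa using ha0))) ?_
  refine mul_map_eq_of_div_mul_map_div_eq (ι := (aeval x : L[X] →ₐ[L] M).toRingHom)
    (transcendental_iff_injective.mp hx) (fun P => (aeval_mapRingHom_restrict hL hσx P).symm)
    hQ (hza.trans ?_)
  simp [Algebra.algebraMap_eq_smul_one, Subfield.smul_def]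

end SimpleTranscendental

section Laurent

open LaurentPolynomial (T)

variable {F : Type*} [Field F]

theorem exists_eq_C_mul_T_of_isUnit {u : F[T;T⁻¹]} (hu : IsUnit u) :
    ∃ (w : F) (n : ℤ), u = LaurentPolynomial.C w * T n := by
  obtain ⟨v, huv⟩ := hu.exists_right_inv
  obtain ⟨m, p, hp⟩ := u.exists_T_pow
  obtain ⟨n, q, hq⟩ := v.exists_T_pow
  have hpq : p * q = X ^ (m + n) := by
    apply toLaurent_injective
    rw [map_mul, hp, hq, mul_mul_mul_comm, huv, toLaurent_X_pow, one_mul, ← LaurentPolynomial.T_add]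
    norm_cast
  obtain ⟨k, -, w, hw⟩ := (dvd_prime_pow prime_X _).mp (Dvd.intro q hpq)
  obtain ⟨r, -, hr⟩ := Polynomial.isUnit_iff.mp w⁻¹.isUnit
  refine ⟨r, k - m, ?_⟩
  rw [← Units.eq_mul_inv_iff_mul_eq, ← hr] at hw
  rw [LaurentPolynomial.T_sub, ← mul_assoc, ← toLaurent_C_mul_T, ← C_mul_X_pow_eq_monomial,
    mul_comm (C r), ← hw, hp, LaurentPolynomial.mul_T_assoc, add_neg_cancel,
    LaurentPolynomial.T_zero, mul_one]

theorem laurentPolynomial_ringHom_ext {R S : Type*} [CommSemiring R] [CommSemiring S]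
    {f g : R[T;T⁻¹] →+* S} (hC : ∀ r, f (LaurentPolynomial.C r) = g (LaurentPolynomial.C r))
    (hT : f (T 1) = g (T 1)) : f = g :=
  IsLocalization.ringHom_ext (Submonoid.powers (X : R[X]))
    (Polynomial.ringHom_ext (by simpa) (by simpa))

theorem laurentPolynomial_eval₂_injective {L M : Type*} [CommRing L] [CommRing M] [Algebra L M]
    {t : Mˣ} (ht : Transcendental L (t : M)) :
    Function.Injective (LaurentPolynomial.eval₂ (algebraMap L M) t) := by
  refine (injective_iff_map_eq_zero _).mpr fun f hf => ?_
  obtain ⟨n, p, hp⟩ := f.exists_T_pow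
  have hp0 : p = 0 := (transcendental_iff.mp ht) p <| by
    rw [aeval_def, ← LaurentPolynomial.eval₂_toLaurent, hp, map_mul, hf, zero_mul]
  rwa [hp0, map_zero, eq_comm, (LaurentPolynomial.isUnit_T _).mul_left_eq_zero] at hp

/-- The extension of `τ` to Laurent polynomials which sends `T` to `c T⁻¹`. -/
noncomputable def laurentReflection (τ : F →+* F) (c : Fˣ) : F[T;T⁻¹] →+* F[T;T⁻¹] :=
  LaurentPolynomial.eval₂ (LaurentPolynomial.C.comp τ)
    { val := LaurentPolynomial.C (c : F) * T (-1)
      inv := LaurentPolynomial.C ((c⁻¹ : Fˣ) : F) * T 1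
      val_inv := by
        rw [mul_mul_mul_comm, ← map_mul, ← LaurentPolynomial.T_add]
        simp
      inv_val := by
        rw [mul_mul_mul_comm, ← map_mul, ← LaurentPolynomial.T_add]
        simp }

theorem laurentReflection_C (τ : F →+* F) (c : Fˣ) (w : F) :
    laurentReflection τ c (.C w) = .C (τ w) :=
  LaurentPolynomial.eval₂_C ..

theorem laurentReflection_T_one (τ : F →+* F) (c : Fˣ) :
    laurentReflection τ c (T 1) = .C (c : F) * T (-1) := by
  rw [laurentReflection, LaurentPolynomial.eval₂_T, zpow_one]

theorem laurentReflection_T_neg_one (τ : F →+* F) (c : Fˣ) :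
    laurentReflection τ c (T (-1)) = .C (c⁻¹ : F) * T 1 := by
  rw [laurentReflection, LaurentPolynomial.eval₂_T, zpow_neg_one, ← Units.val_inv_eq_inv_val]
  rfl

theorem laurentReflection_involutive {τ : F →+* F} (hτ : Function.Involutive τ) {c : Fˣ}
    (hc : τ c = c) : Function.Involutive (laurentReflection τ c) := by
  refine DFunLike.congr_fun (f := (laurentReflection τ c).comp (laurentReflection τ c))
    (g := RingHom.id _) (laurentPolynomial_ringHom_ext (fun w => ?_) ?_)
  · simp [laurentReflection_C, hτ w]
  · rw [RingHom.comp_apply, laurentReflection_T_one, map_mul, laurentReflection_C, hc,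
      laurentReflection_T_neg_one, ← mul_assoc, ← map_mul]
    simp

theorem eval₂_laurentReflection {M : Type*} [Field M] {σ : M →+* M} {f : F →+* M} {τ : F →+* F}
    (hτ : ∀ w, f (τ w) = σ (f w)) {c : Fˣ} {t : Mˣ} (ht : t * σ t = f c) (p : F[T;T⁻¹]) :
    LaurentPolynomial.eval₂ f t (laurentReflection τ c p) = σ (LaurentPolynomial.eval₂ f t p) := by
  refine DFunLike.congr_fun (f := (LaurentPolynomial.eval₂ f t).comp (laurentReflection τ c))
    (g := σ.comp _) (laurentPolynomial_ringHom_ext (fun w => ?_) ?_) p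
  · simp [laurentReflection_C, hτ w]
  · simp [laurentReflection_T_one, ← ht, mul_right_comm]

end Laurent

section TwoStep

variable {M : Type*} [Field M] {σ : M →+* M} {L : Subfield M} {a b c d x t : M}

theorem IsInvolutionNorm.of_adjoin_reflected (hσ : Function.Involutive σ)
    (hL : ∀ z ∈ L, σ z ∈ L) (ht : Transcendental L t) (hc : c ∈ L) (htc : t * σ t = c)
    (ha : a ∈ L) (ha0 : a ≠ 0) (h : IsInvolutionNorm σ L⟮t⟯.toSubfield a) :
    ∃ n : ℤ, IsInvolutionNorm σ L (a * c ^ n) := by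
  have ht0 : t ≠ 0 := fun h0 => ht (h0 ▸ isAlgebraic_zero)
  have hc0 : c ≠ 0 := htc ▸ mul_ne_zero ht0 ((map_ne_zero σ).mpr ht0)
  lift a to L using ha
  lift c to L using hc
  lift c to Lˣ using IsUnit.mk0 c (by simpa using hc0)
  lift t to Mˣ using ht0.isUnit
  let ι := LaurentPolynomial.eval₂ (algebraMap L M) t
  let τ := σ.restrict L L hL
  have hσι := eval₂_laurentReflection (τ := τ) (f := algebraMap L M) (fun _ => rfl) htc
  obtain ⟨z, hz, hza⟩ := h
  obtain ⟨P, Q, hPQ, hQ, rfl⟩ := exists_isCoprime_of_mem_adjoin_simple hz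
  have hι (p : L[X]) : ι (toLaurent p) = aeval (t : M) p := LaurentPolynomial.eval₂_toLaurent ..
  rw [← hι] at hQ
  have hnorm : toLaurent P * laurentReflection τ c (toLaurent P) =
      .C a * (toLaurent Q * laurentReflection τ c (toLaurent Q)) :=
    mul_map_eq_of_div_mul_map_div_eq (laurentPolynomial_eval₂_injective ht)
      (fun p => (hσι p).symm) hQ
      (by rw [hι, hι, hza]; exact (LaurentPolynomial.eval₂_C (algebraMap L M) t a).symm)
  have hτc : τ c = c := Subtype.ext <| by
    change σ c = c
    rw [← htc, map_mul, hσ, mul_comm]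
  obtain ⟨u, hu, hua⟩ := exists_isUnit_mul_map_eq
    (laurentReflection_involutive (restrict_involutive hσ hL) hτc) (hPQ.map toLaurent)
    (fun h => by simp [h] at hQ) ((IsUnit.mk0 a (by simpa using ha0)).map LaurentPolynomial.C) hnorm
  obtain ⟨w, n, rfl⟩ := exists_eq_C_mul_T_of_isUnit hu
  have hwa : w * σ w * c ^ n = (a : M) := by
    have hu_norm := congrArg ι hua
    rw [map_mul ι, hσι] at hu_norm
    simp only [ι, LaurentPolynomial.eval₂_T, LaurentPolynomial.eval₂_C, map_mul,
      Units.val_zpow_eq_zpow_val, map_zpow₀] at hu_norm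
    rw [← htc, mul_zpow, mul_mul_mul_comm]
    exact hu_norm
  exact ⟨-n, w, w.2, by rw [← hwa, mul_assoc, ← zpow_add₀ hc0]; simp⟩

theorem isInvolutionNorm_zpow_of_even (hc : c ∈ L) (hσc : σ c = c) {n : ℤ} (hn : Even n) :
    IsInvolutionNorm σ L (c ^ n) := by
  obtain ⟨k, rfl⟩ := hn
  exact ⟨c ^ k, zpow_mem hc k, by rw [map_zpow₀, hσc, zpow_add' (by omega)]⟩

theorem map_mem_adjoin_simple (hL : ∀ z ∈ L, σ z ∈ L) (hx : σ x ∈ L⟮x⟯) :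
    ∀ z ∈ L⟮x⟯.toSubfield, σ z ∈ L⟮x⟯.toSubfield := by
  change L⟮x⟯.toSubfield ≤ L⟮x⟯.toSubfield.comap σ
  rw [IntermediateField.adjoin_toSubfield, Subfield.closure_le, Set.union_subset_iff,
    Set.singleton_subset_iff, ← IntermediateField.adjoin_toSubfield]
  refine ⟨?_, hx⟩
  rintro _ ⟨z, rfl⟩
  exact L⟮x⟯.algebraMap_mem ⟨σ z, hL z z.2⟩

theorem map_self_mem_adjoin_simple (ht : t * σ t ∈ L) : σ t ∈ L⟮t⟯ := by
  obtain rfl | ht0 := eq_or_ne t 0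
  · rw [map_zero]
    exact zero_mem _
  · rw [← mul_div_cancel_left₀ (σ t) ht0]
    exact div_mem (L⟮t⟯.algebraMap_mem ⟨_, ht⟩) (IntermediateField.mem_adjoin_simple_self L t)

theorem IsInvolutionNorm.of_adjoin_adjoin (hσ : Function.Involutive σ) (hL : ∀ z ∈ L, σ z ∈ L)
    (hx : Transcendental L x) (hσx : σ x = x) (hb : b ∈ L) (hb0 : b ≠ 0) (hd : d ∈ L)
    (hσd : σ d = d) (hsq : ∀ z ∈ L, z ^ 2 ≠ -d) (ht : Transcendental L⟮x⟯.toSubfield t)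
    (htσt : t * σ t = b * (x ^ 2 + d)) (ha : a ∈ L)
    (h : IsInvolutionNorm σ (L⟮x⟯.toSubfield)⟮t⟯.toSubfield a) : IsInvolutionNorm σ L a := by
  set L₁ := L⟮x⟯.toSubfield
  have hLL₁ : L ≤ L₁ := fun z hz => L⟮x⟯.algebraMap_mem ⟨z, hz⟩
  have hxL₁ : x ∈ L₁ := IntermediateField.mem_adjoin_simple_self L x
  obtain rfl | ha0 := eq_or_ne a 0
  · exact ⟨0, zero_mem L, zero_mul _⟩
  set c := b * (x ^ 2 + d)
  have hcL₁ : c ∈ L₁ := mul_mem (hLL₁ hb) (add_mem (pow_mem hxL₁ 2) (hLL₁ hd))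
  have hσc : σ c = c := by rw [← htσt, map_mul, hσ, mul_comm]
  have ht0 : t ≠ 0 := fun h0 => ht (h0 ▸ isAlgebraic_zero)
  have hc0 : c ≠ 0 := htσt ▸ mul_ne_zero ht0 ((map_ne_zero σ).mpr ht0)
  obtain ⟨n, hn⟩ := IsInvolutionNorm.of_adjoin_reflected hσ
    (map_mem_adjoin_simple hL (hσx.symm ▸ IntermediateField.mem_adjoin_simple_self L x)) ht hcL₁
    htσt (hLL₁ ha) ha0 h
  rcases Int.even_or_odd n with hne | hno
  · have h₁ := hn.mul (isInvolutionNorm_zpow_of_even hcL₁ hσc hne.neg)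
    rw [mul_assoc, ← zpow_add₀ hc0, add_neg_cancel, zpow_zero, mul_one] at h₁
    exact h₁.of_adjoin_fixed hσ hL hx hσx ha ha0
  · have h₁ := hn.mul (isInvolutionNorm_zpow_of_even hcL₁ hσc hno.neg.add_one)
    rw [mul_assoc, ← zpow_add₀ hc0, add_neg_cancel_left, zpow_one, ← mul_assoc] at h₁
    exact absurd h₁ (not_isInvolutionNorm_adjoin_fixed hσ hL hx hσx (mul_mem ha hb)
      (mul_ne_zero ha0 hb0) hd hσd hsq)

end TwoStep

theorem exists_ge_forall_of_countable {P ι : Type*} [Preorder P] [Countable ι]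
    (hsup : ∀ f : ℕ →o P, ∃ q, ∀ n, f n ≤ q) {S : ι → P → Prop} (hS : ∀ i, Monotone (S i))
    (p : P) (hstep : ∀ i, ∀ q ≥ p, ∃ r ≥ q, S i r) : ∃ q ≥ p, ∀ i, S i q := by
  have := Encodable.ofCountable ι
  let 𝒟 (i : ι) : Order.Cofinal (Set.Ici p) :=
    { carrier := {q | S i q}
      isCofinal := fun q =>
        let ⟨r, hqr, hr⟩ := hstep i q q.2
        ⟨⟨r, le_trans q.2 hqr⟩, hr, hqr⟩ }
  let f : ℕ →o Set.Ici p :=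
    ⟨Order.sequenceOfCofinals ⟨p, Set.self_mem_Ici⟩ 𝒟, Order.sequenceOfCofinals.monotone _ _⟩
  obtain ⟨q, hq⟩ := hsup ((OrderHom.Subtype.val _).comp f)
  exact ⟨q, (f 0).2.trans (hq 0), fun i => hS i (hq (Encodable.encode i + 1))
    (Order.sequenceOfCofinals.encode_mem _ 𝒟 i)⟩

theorem exists_ge_forall_mem_of_countable {P τ : Type*} [Preorder P] {T : P → Set τ}
    (hT : Monotone T) (hT_countable : ∀ p, (T p).Countable) {S : τ → P → Prop}
    (hS : ∀ i, Monotone (S i)) (hsup : ∀ f : ℕ →o P, ∃ q, (∀ n, f n ≤ q) ∧ T q ⊆ ⋃ n, T (f n))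
    (hstep : ∀ p, ∀ i ∈ T p, ∃ q ≥ p, S i q) (p : P) : ∃ q ≥ p, ∀ i ∈ T q, S i q := by
  have hnext (p : P) : ∃ q ≥ p, ∀ i : T p, S i q := by
    have := (hT_countable p).to_subtype
    exact exists_ge_forall_of_countable (S := fun i : T p => S i)
      (fun f => (hsup f).imp fun _ => And.left) (fun i => hS i) p
      fun i q hq => hstep q i (hT hq i.2)
  choose next le_next hnext using hnext
  let f : ℕ →o P := ⟨fun n => next^[n] p, monotone_nat_of_le_succ fun n => by
    rw [Function.iterate_succ_apply']
    exact le_next _⟩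
  obtain ⟨q, hfq, hTq⟩ := hsup f
  refine ⟨q, hfq 0, fun i hi => ?_⟩
  obtain ⟨n, hn⟩ := Set.mem_iUnion.mp (hTq hi)
  refine hS i (hfq (n + 1)) ?_
  change S i (next^[n + 1] p)
  rw [Function.iterate_succ_apply']
  exact hnext _ ⟨i, hn⟩

theorem exists_mem_transcendental {F E : Type*} [Field F] [Countable F] [Field E] [Algebra F E]
    {f : ℝ → E} (hf : Function.Injective f) {U : Set ℝ} (hU : IsOpen U) (hne : U.Nonempty) :
    ∃ y ∈ U, Transcendental F (f y) := by
  have hcount : (f ⁻¹' {z | IsAlgebraic F z}).Countable :=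
    (Algebraic.countable F E).preimage hf
  obtain ⟨y, hyU, hy⟩ := (hcount.dense_compl ℝ).inter_open_nonempty U hU hne
  exact ⟨y, hyU, hy⟩

theorem countable_adjoin_simple {F E : Type*} [Field F] [Countable F] [Field E] [Algebra F E]
    (x : E) : Countable F⟮x⟯ := by
  rw [← Cardinal.mk_le_aleph0_iff, ← Cardinal.lift_le_aleph0]
  refine (IntermediateField.lift_cardinalMk_adjoin_le F {x}).trans ?_
  simp

theorem exists_normSq_eq_transcendental {L : Subfield ℂ} [Countable L] {c : ℝ} (hc : 0 < c) :
    ∃ t : ℂ, t * conj t = c ∧ Transcendental L t := by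
  have hinj : Function.Injective fun y : ℝ => (⟨y, √(c - y ^ 2)⟩ : ℂ) :=
    fun _ _ h => congrArg Complex.re h
  obtain ⟨y, hy, hyt⟩ := exists_mem_transcendental (F := L) hinj
    (U := {y | 0 < c - y ^ 2}) (isOpen_lt continuous_const (by fun_prop)) ⟨0, by simpa⟩
  refine ⟨_, ?_, hyt⟩
  rw [Complex.mul_conj, Complex.normSq_mk, Real.mul_self_sqrt (le_of_lt hy)]
  congr 1
  ring

section NormConservative

/-- A countable extension `L'` of `L` inside `ℂ`, stable under complex conjugation, in which no
further element of `L` becomes a norm `z * conj z`. -/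
structure IsNormConservative (L L' : Subfield ℂ) : Prop where
  le : L ≤ L'
  countable : Countable L'
  conj_mem : ∀ z ∈ L', conj z ∈ L'
  norm : ∀ a ∈ L, IsInvolutionNorm (starRingEnd ℂ) L' a → IsInvolutionNorm (starRingEnd ℂ) L a

variable {L L' L'' : Subfield ℂ} {b d : ℝ}

theorem IsNormConservative.trans (h : IsNormConservative L L') (h' : IsNormConservative L' L'') :
    IsNormConservative L L'' where
  le := h.le.trans h'.le
  countable := h'.countable
  conj_mem := h'.conj_mem
  norm a ha hn := h.norm a ha (h'.norm a (h.le ha) hn)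

theorem IsNormConservative.iSup {f : ℕ → Subfield ℂ} (hf : Monotone f)
    (h : ∀ n, IsNormConservative L (f n)) : IsNormConservative L (⨆ n, f n) where
  le := (h 0).le.trans (le_iSup f 0)
  countable := by
    have (n : ℕ) := (h n).countable
    change Countable ((⨆ n, f n : Subfield ℂ) : Set ℂ)
    rw [Subfield.coe_iSup_of_directed hf.directed_le]
    exact (Set.countable_iUnion fun n => (h n).countable).to_subtype
  conj_mem z hz := by
    rw [Subfield.mem_iSup_of_directed hf.directed_le] at hz ⊢
    exact hz.imp fun n => (h n).conj_mem z
  norm a ha := by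
    rintro ⟨w, hw, hwa⟩
    obtain ⟨n, hn⟩ := (Subfield.mem_iSup_of_directed hf.directed_le).mp hw
    exact (h n).norm a ha ⟨w, hn, hwa⟩

theorem re_mem_of_conj_mem (hL : ∀ z ∈ L, conj z ∈ L) {z : ℂ} (hz : z ∈ L) :
    (z.re : ℂ) ∈ L := by
  rw [Complex.re_eq_add_conj]
  exact div_mem (add_mem hz (hL z hz)) (ofNat_mem L 2)

theorem im_mem_of_conj_mem (hI : Complex.I ∈ L) (hL : ∀ z ∈ L, conj z ∈ L) {z : ℂ} (hz : z ∈ L) :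
    (z.im : ℂ) ∈ L := by
  rw [Complex.im_eq_sub_conj]
  exact div_mem (sub_mem hz (hL z hz)) (mul_mem (ofNat_mem L 2) hI)

/-- `d` is represented over `L ∩ ℝ` by the form `-x ^ 2 + b * y ^ 2 + b * z ^ 2`, the restriction of
the square to the pure quaternions in `(-1, b)`. -/
def IsPureSquare (L : Subfield ℂ) (b d : ℝ) : Prop :=
  ∃ x y z : ℝ, (x : ℂ) ∈ L ∧ (y : ℂ) ∈ L ∧ (z : ℂ) ∈ L ∧ d = -x ^ 2 + b * y ^ 2 + b * z ^ 2

theorem exists_isNormConservative_isPureSquare [Countable L] (hI : Complex.I ∈ L)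
    (hL : ∀ z ∈ L, conj z ∈ L) (hbL : (b : ℂ) ∈ L) (hdL : (d : ℂ) ∈ L) (hb : 0 < b)
    (hsq : ∀ z ∈ L, z ^ 2 ≠ -(d : ℂ)) : ∃ L', IsNormConservative L L' ∧ IsPureSquare L' b d := by
  obtain ⟨x, hxd, hx⟩ := exists_mem_transcendental (F := L) Complex.ofReal_injective
    (U := {x | 0 < x ^ 2 + d}) (isOpen_lt continuous_const (by fun_prop))
    ⟨|d| + 1, by rw [Set.mem_ofPred_eq]; nlinarith [neg_abs_le d, abs_nonneg d]⟩
  set L₁ := L⟮(x : ℂ)⟯.toSubfield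
  have : Countable L₁ := countable_adjoin_simple (F := L) (x : ℂ)
  obtain ⟨t, htt, ht⟩ := exists_normSq_eq_transcendental (L := L₁) (mul_pos hb hxd)
  set L₂ := L₁⟮t⟯.toSubfield
  have hLL₁ : L ≤ L₁ := fun z hz => L⟮(x : ℂ)⟯.algebraMap_mem ⟨z, hz⟩
  have hL₁L₂ : L₁ ≤ L₂ := fun z hz => L₁⟮t⟯.algebraMap_mem ⟨z, hz⟩
  have hxL₁ : (x : ℂ) ∈ L₁ := IntermediateField.mem_adjoin_simple_self L (x : ℂ)
  have htL₂ : t ∈ L₂ := IntermediateField.mem_adjoin_simple_self L₁ t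
  have hL₁ : ∀ z ∈ L₁, conj z ∈ L₁ :=
    map_mem_adjoin_simple hL ((Complex.conj_ofReal x).symm ▸ hxL₁)
  have hcL₁ : t * conj t ∈ L₁ := by
    rw [htt]
    exact_mod_cast mul_mem (hLL₁ hbL) (add_mem (pow_mem hxL₁ 2) (hLL₁ hdL))
  have hL₂ : ∀ z ∈ L₂, conj z ∈ L₂ :=
    map_mem_adjoin_simple hL₁ (map_self_mem_adjoin_simple hcL₁)
  refine ⟨L₂, ⟨hLL₁.trans hL₁L₂, countable_adjoin_simple (F := L₁) t, hL₂, fun a ha =>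
    IsInvolutionNorm.of_adjoin_adjoin Complex.conj_conj hL hx (Complex.conj_ofReal x) hbL
      (Complex.ofReal_ne_zero.mpr hb.ne') hdL (Complex.conj_ofReal d) hsq ht (mod_cast htt) ha⟩, ?_⟩
  -- `t * conj t = b * (x ^ 2 + d)` says that `d = -x ^ 2 + b * |t / b| ^ 2`.
  have hs : t / b ∈ L₂ := div_mem htL₂ (hL₁L₂ (hLL₁ hbL))
  refine ⟨x, (t / b).re, (t / b).im, hL₁L₂ hxL₁, re_mem_of_conj_mem hL₂ hs,
    im_mem_of_conj_mem (hL₁L₂ (hLL₁ hI)) hL₂ hs, ?_⟩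
  rw [Complex.mul_conj, Complex.ofReal_inj, Complex.normSq_apply] at htt
  simp only [Complex.div_ofReal_re, Complex.div_ofReal_im]
  field_simp
  linear_combination -htt

theorem IsPureSquare.mono (h : L ≤ L') (hd : IsPureSquare L b d) : IsPureSquare L' b d := by
  obtain ⟨x, y, z, hx, hy, hz, rfl⟩ := hd
  exact ⟨x, y, z, h hx, h hy, h hz, rfl⟩

theorem exists_isNormConservative_forall_isPureSquare [Countable L] (hI : Complex.I ∈ L)
    (hL : ∀ z ∈ L, conj z ∈ L) : ∃ L', IsNormConservative L L' ∧
      ∀ b d : ℝ, (b : ℂ) ∈ L' → (d : ℂ) ∈ L' → 0 < b →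
        (∃ z ∈ L', z ^ 2 = -(d : ℂ)) ∨ IsPureSquare L' b d := by
  let T (E : {E // IsNormConservative L E}) : Set (ℝ × ℝ) :=
    {i | 0 < i.1 ∧ (i.1 : ℂ) ∈ E.1 ∧ (i.2 : ℂ) ∈ E.1}
  let S (i : ℝ × ℝ) (E : {E // IsNormConservative L E}) : Prop :=
    (∃ z ∈ E.1, z ^ 2 = -(i.2 : ℂ)) ∨ IsPureSquare E.1 i.1 i.2
  have hT : Monotone T := fun _ _ h _ => And.imp_right (And.imp (@h _) (@h _))
  have hT_countable (E) : (T E).Countable := by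
    have := E.2.countable
    have hE : {x : ℝ | (x : ℂ) ∈ E.1}.Countable :=
      (Set.to_countable (E.1 : Set ℂ)).preimage Complex.ofReal_injective
    exact (hE.prod hE).mono fun _ hi => hi.2
  have hS (i : ℝ × ℝ) : Monotone (S i) := fun _ _ h => Or.imp
    (fun ⟨z, hz, hzd⟩ => ⟨z, h hz, hzd⟩) (IsPureSquare.mono h)
  have hsup (f : ℕ →o {E // IsNormConservative L E}) :
      ∃ E, (∀ n, f n ≤ E) ∧ T E ⊆ ⋃ n, T (f n) := by
    have hf : Monotone fun n => (f n).1 := f.monotone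
    refine ⟨⟨_, .iSup hf fun n => (f n).2⟩, le_iSup fun n => (f n).1, fun i ⟨hb, hbE, hdE⟩ => ?_⟩
    obtain ⟨m, hm⟩ := (Subfield.mem_iSup_of_directed hf.directed_le).mp hbE
    obtain ⟨n, hn⟩ := (Subfield.mem_iSup_of_directed hf.directed_le).mp hdE
    exact Set.mem_iUnion.mpr ⟨max m n, hb, hf (le_max_left m n) hm, hf (le_max_right m n) hn⟩
  have hstep (E) (i) (hi : i ∈ T E) : ∃ E' ≥ E, S i E' := by
    have := E.2.countable
    by_cases! hsq : ∃ z ∈ E.1, z ^ 2 = -(i.2 : ℂ)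
    · exact ⟨E, le_rfl, .inl hsq⟩
    obtain ⟨E', hE', hbd⟩ := exists_isNormConservative_isPureSquare (E.2.le hI) E.2.conj_mem
      hi.2.1 hi.2.2 hi.1 hsq
    exact ⟨⟨E', E.2.trans hE'⟩, hE'.le, .inr hbd⟩
  obtain ⟨E, -, hE⟩ := exists_ge_forall_mem_of_countable hT hT_countable hS hsup hstep
    ⟨L, le_rfl, inferInstance, hL, fun _ _ => id⟩
  exact ⟨E.1, E.2, fun b d hb hd hb0 => hE (b, d) ⟨hb0, hb, hd⟩⟩

end NormConservative

/-- The field `K(i)` of a subfield `K` of `ℝ`. -/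
def gaussianSubfield (K : Subfield ℝ) : Subfield ℂ where
  carrier := {z | z.re ∈ K ∧ z.im ∈ K}
  mul_mem' hz hw := ⟨sub_mem (mul_mem hz.1 hw.1) (mul_mem hz.2 hw.2),
    add_mem (mul_mem hz.1 hw.2) (mul_mem hz.2 hw.1)⟩
  one_mem' := ⟨one_mem K, zero_mem K⟩
  add_mem' hz hw := ⟨add_mem hz.1 hw.1, add_mem hz.2 hw.2⟩
  zero_mem' := ⟨zero_mem K, zero_mem K⟩
  neg_mem' hz := ⟨neg_mem hz.1, neg_mem hz.2⟩
  inv_mem' z hz := by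
    have hn : Complex.normSq z ∈ K := add_mem (mul_mem hz.1 hz.1) (mul_mem hz.2 hz.2)
    exact ⟨Complex.inv_re z ▸ div_mem hz.1 hn, Complex.inv_im z ▸ div_mem (neg_mem hz.2) hn⟩

theorem countable_gaussianSubfield {K : Subfield ℝ} [Countable K] :
    Countable (gaussianSubfield K) :=
  Function.Injective.countable
    (f := fun z : gaussianSubfield K => ((⟨_, z.2.1⟩, ⟨_, z.2.2⟩) : K × K))
    fun _ _ h => Subtype.ext <| Complex.ext (congrArg (fun p => (p.1 : ℝ)) h)
      (congrArg (fun p => (p.2 : ℝ)) h)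

theorem isInvolutionNorm_gaussianSubfield_iff {K : Subfield ℝ} {a : ℝ} :
    IsInvolutionNorm (starRingEnd ℂ) (gaussianSubfield K) a ↔
      ∃ x ∈ K, ∃ y ∈ K, x ^ 2 + y ^ 2 = a := by
  constructor
  · rintro ⟨w, hw, hwa⟩
    refine ⟨_, hw.1, _, hw.2, ?_⟩
    rwa [Complex.mul_conj, Complex.ofReal_inj, Complex.normSq_apply, ← sq, ← sq] at hwa
  · rintro ⟨x, hx, y, hy, rfl⟩
    refine ⟨⟨x, y⟩, ⟨hx, hy⟩, ?_⟩
    rw [Complex.mul_conj, Complex.ofReal_inj, Complex.normSq_apply, ← sq, ← sq]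

theorem eq_mul_self_or_eq_neg_sq_of_mem_gaussianSubfield {K : Subfield ℝ} {d : ℝ} {z : ℂ}
    (hz : z ∈ gaussianSubfield K) (hzd : z ^ 2 = -(d : ℂ)) :
    (∃ x ∈ K, d = x * x) ∨ ∃ x ∈ K, d = -x ^ 2 := by
  have hre := congrArg Complex.re hzd
  have him := congrArg Complex.im hzd
  simp only [sq, Complex.mul_re, Complex.mul_im, Complex.neg_re, Complex.neg_im, Complex.ofReal_re,
    Complex.ofReal_im, neg_zero] at hre him
  have h0 : z.re = 0 ∨ z.im = 0 := mul_eq_zero.mp (by linarith)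
  rcases h0 with h | h
  · exact .inl ⟨z.im, hz.2, by rw [h] at hre; linarith⟩
  · exact .inr ⟨z.re, hz.1, by rw [h] at hre; linarith⟩

theorem gaussianSubfield_comap_ofRealHom {L : Subfield ℂ} (hI : Complex.I ∈ L)
    (hL : ∀ z ∈ L, conj z ∈ L) : gaussianSubfield (L.comap Complex.ofRealHom) = L := by
  ext z
  refine ⟨fun hz => ?_, fun hz => ⟨re_mem_of_conj_mem hL hz, im_mem_of_conj_mem hI hL hz⟩⟩
  rw [← Complex.re_add_im z]
  exact add_mem hz.1 (mul_mem hz.2 hI)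

theorem exists_subfield_real_forall_isSquare_or_represented (K₀ : Subfield ℝ) [Countable K₀] :
    ∃ K : Subfield ℝ,
      (∀ a ∈ K₀, (∃ x ∈ K, ∃ y ∈ K, x ^ 2 + y ^ 2 = a) → ∃ x ∈ K₀, ∃ y ∈ K₀, x ^ 2 + y ^ 2 = a) ∧
      ∀ b d : K, 0 < b → IsSquare d ∨ ∃ x y z : K, d = -x ^ 2 + b * y ^ 2 + b * z ^ 2 := by
  have hI : Complex.I ∈ gaussianSubfield K₀ := ⟨zero_mem K₀, one_mem K₀⟩
  have := countable_gaussianSubfield (K := K₀)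
  obtain ⟨L, hL, hrep⟩ := exists_isNormConservative_forall_isPureSquare hI
    fun z hz => ⟨hz.1, neg_mem hz.2⟩
  have hKL := gaussianSubfield_comap_ofRealHom (hL.le hI) hL.conj_mem
  refine ⟨L.comap Complex.ofRealHom, fun a ha => ?_, fun b d hb => ?_⟩
  · rw [← isInvolutionNorm_gaussianSubfield_iff, ← isInvolutionNorm_gaussianSubfield_iff, hKL]
    exact hL.norm a ⟨ha, zero_mem K₀⟩
  rcases hrep b d b.2 d.2 hb with ⟨z, hz, hzd⟩ | ⟨x, y, z, hx, hy, hz, hd⟩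
  · rw [← hKL] at hz
    rcases eq_mul_self_or_eq_neg_sq_of_mem_gaussianSubfield hz hzd with ⟨x, hx, hd⟩ | ⟨x, hx, hd⟩
    · exact .inl ⟨⟨x, hx⟩, Subtype.ext hd⟩
    · exact .inr ⟨⟨x, hx⟩, 0, 0, Subtype.ext (by simpa using hd)⟩
  · exact .inr ⟨⟨x, hx⟩, ⟨y, hy⟩, ⟨z, hz⟩, Subtype.ext hd⟩

theorem even_padicValNat_of_rat_sq_add_sq_eq {p n : ℕ} (hp : p.Prime) (hp4 : p % 4 = 3) {x y : ℚ}
    (h : x ^ 2 + y ^ 2 = n) : Even (padicValNat p n) := by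
  have : Fact p.Prime := ⟨hp⟩
  obtain rfl | hn := eq_or_ne n 0
  · simp
  have hD0 : x.den * y.den ≠ 0 := mul_ne_zero x.den_ne_zero y.den_ne_zero
  have hD : n * (x.den * y.den) ^ 2 = (x.num * y.den).natAbs ^ 2 + (y.num * x.den).natAbs ^ 2 := by
    zify
    rw [sq_abs, sq_abs]
    have : (n * (x.den * y.den) ^ 2 : ℚ) = (x.num * y.den) ^ 2 + (y.num * x.den) ^ 2 := by
      rw [← h, ← Rat.mul_den_eq_num x, ← Rat.mul_den_eq_num y]
      ring
    exact_mod_cast this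
  have heven : Even (padicValNat p (n * (x.den * y.den) ^ 2)) := by
    by_cases hpD : p ∣ n * (x.den * y.den) ^ 2
    · exact Nat.eq_sq_add_sq_iff.mp ⟨_, _, hD⟩ p
        (Nat.mem_primeFactors.mpr ⟨hp, hpD, mul_ne_zero hn (pow_ne_zero 2 hD0)⟩) hp4
    · simp [padicValNat.eq_zero_of_not_dvd hpD]
  rw [padicValNat.mul hn (pow_ne_zero 2 hD0), padicValNat.pow] at heven
  exact (Nat.even_add.mp heven).mpr (even_two_mul _)

section SquareRoot

variable {k A : Type*} [Field k] [Ring A] [Algebra k A] {e : A} {d : k}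

theorem not_isSquare_of_mul_self_eq_algebraMap [NoZeroDivisors A]
    (he : ∀ c : k, e ≠ algebraMap k A c) (hd : e * e = algebraMap k A d) : ¬ IsSquare d := by
  rintro ⟨c, rfl⟩
  rw [map_mul, Commute.mul_self_eq_mul_self_iff (Algebra.commutes c e).symm, ← map_neg] at hd
  exact hd.elim (he c) (he (-c))

/-- The homomorphism from `k(√d)` to a `k`-algebra given by a square root of `d`. -/
def sqrtHom (hd : e * e = algebraMap k A d) : QuadraticAlgebra k d 0 →ₐ[k] A :=
  QuadraticAlgebra.lift ⟨e, by rw [hd, zero_smul, add_zero, Algebra.algebraMap_eq_smul_one]⟩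

theorem mem_range_sqrtHom (hd : e * e = algebraMap k A d) {z : A} :
    z ∈ (sqrtHom hd).range ↔ ∃ α β : k, z = α • 1 + β • e :=
  ⟨fun ⟨t, ht⟩ => ⟨t.re, t.im, ht.symm⟩, fun ⟨α, β, h⟩ => ⟨⟨α, β⟩, h.symm⟩⟩

theorem self_mem_range_sqrtHom (hd : e * e = algebraMap k A d) : e ∈ (sqrtHom hd).range :=
  (mem_range_sqrtHom hd).mpr ⟨0, 1, by simp⟩

theorem range_sqrtHom_le (hd : e * e = algebraMap k A d) {S : Subalgebra k A} (he : e ∈ S) :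
    (sqrtHom hd).range ≤ S := by
  intro z hz
  obtain ⟨α, β, rfl⟩ := (mem_range_sqrtHom hd).mp hz
  exact add_mem (S.smul_mem (one_mem S) α) (S.smul_mem he β)

theorem isField_quadraticAlgebra (hd : ¬ IsSquare d) : IsField (QuadraticAlgebra k d 0) := by
  have : Fact (∀ r : k, r ^ 2 ≠ d + 0 * r) :=
    ⟨fun r hr => hd ⟨r, by rw [← sq, hr, zero_mul, add_zero]⟩⟩
  exact Field.toIsField _

theorem sqrtHom_injective [Nontrivial A] (hd : e * e = algebraMap k A d) (hsq : ¬ IsSquare d) :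
    Function.Injective (sqrtHom hd) :=
  letI := (isField_quadraticAlgebra hsq).toField
  (sqrtHom hd : QuadraticAlgebra k d 0 →+* A).injective

theorem isField_range_sqrtHom [Nontrivial A] (hd : e * e = algebraMap k A d)
    (hsq : ¬ IsSquare d) : IsField (sqrtHom hd).range :=
  (AlgEquiv.ofInjective _ (sqrtHom_injective hd hsq)).symm.toMulEquiv.isField
    (isField_quadraticAlgebra hsq)

end SquareRoot

section Quaternion

open QuaternionAlgebra

variable {k : Type*} [Field k] {a b c : k}

theorem quaternion_eq_zero_of_star_mul_self_eq_zero (ha : ¬ IsSquare a)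
    (hb : ∀ x y : k, x ^ 2 - a * y ^ 2 ≠ b) {z : ℍ[k,a,b]} (hz : star z * z = 0) : z = 0 := by
  have hnorm {x y : k} (h : x ^ 2 - a * y ^ 2 = 0) : x = 0 ∧ y = 0 := by
    have hy : y = 0 := by
      by_contra hy
      exact ha ⟨x / y, by field_simp; linear_combination -h⟩
    exact ⟨by simpa [hy] using h, hy⟩
  obtain ⟨x, y, s, t⟩ := z
  have h : x ^ 2 - a * y ^ 2 = b * (s ^ 2 - a * t ^ 2) := by
    have hre := congrArg re hz
    simp only [star_mk, zero_mul, add_zero, mk_mul_mk, re_zero] at hre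
    linear_combination hre
  have hst : s ^ 2 - a * t ^ 2 = 0 := by
    by_contra hst
    refine hb ((x * s - a * y * t) / (s ^ 2 - a * t ^ 2))
      ((y * s - x * t) / (s ^ 2 - a * t ^ 2)) ?_
    field_simp
    linear_combination (s ^ 2 - a * t ^ 2) * h
  rw [hst, mul_zero] at h
  ext
  exacts [(hnorm h).1, (hnorm h).2, (hnorm hst).1, (hnorm hst).2]

theorem quaternion_noZeroDivisors (ha : ¬ IsSquare a) (hb : ∀ x y : k, x ^ 2 - a * y ^ 2 ≠ b) :
    NoZeroDivisors ℍ[k,a,b] := by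
  refine ⟨fun {z w} hzw => ?_⟩
  have h : (star z * z).re • w = 0 := by
    rw [← coe_mul_eq_smul, ← star_mul_eq_coe, mul_assoc, hzw, mul_zero]
  refine (smul_eq_zero.mp h).imp_left fun h0 => ?_
  apply quaternion_eq_zero_of_star_mul_self_eq_zero ha hb
  rw [star_mul_eq_coe, h0, QuaternionAlgebra.coe_zero]

theorem quaternion_left_ne_zero [NoZeroDivisors ℍ[k,a,b]] : a ≠ 0 := by
  rintro rfl
  have : (⟨0, 1, 0, 0⟩ : ℍ[k,0,b]) * ⟨0, 1, 0, 0⟩ = 0 := by ext <;> simp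
  exact one_ne_zero (congrArg imI (mul_self_eq_zero.mp this))

theorem quaternion_right_ne_zero [NoZeroDivisors ℍ[k,a,b]] : b ≠ 0 := by
  rintro rfl
  have : (⟨0, 0, 1, 0⟩ : ℍ[k,a,0]) * ⟨0, 0, 1, 0⟩ = 0 := by ext <;> simp
  exact one_ne_zero (congrArg imJ (mul_self_eq_zero.mp this))

theorem quaternion_mul_self_of_re_eq_zero {z : ℍ[k,a,b]} (hz : z.re = 0) :
    z * z = algebraMap k _ (a * z.imI ^ 2 + b * z.imJ ^ 2 - a * b * z.imK ^ 2) := by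
  rw [QuaternionAlgebra.algebraMap_eq]
  ext <;> simp [hz] <;> ring

theorem quaternion_mul_self_of_anticommute (h2 : (2 : k) ≠ 0) (ha : a ≠ 0) {u : ℍ[k,a,b]}
    (hu : ⟨0, 1, 0, 0⟩ * u = -(u * ⟨0, 1, 0, 0⟩)) :
    u * u = algebraMap k _ (b * (u.imJ ^ 2 - a * u.imK ^ 2)) := by
  have hre : u.re = 0 := by
    have h : u.re = -u.re := by simpa using congrArg imI hu
    exact (mul_eq_zero.mp (show 2 * u.re = 0 by linear_combination h)).resolve_left h2
  have himI : u.imI = 0 := by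
    have h : a * u.imI = -(a * u.imI) := by simpa using congrArg re hu
    exact (mul_eq_zero.mp (show 2 * a * u.imI = 0 by linear_combination h)).resolve_left
      (mul_ne_zero h2 ha)
  rw [quaternion_mul_self_of_re_eq_zero hre, himI]
  ring_nf

theorem quaternion_exists_eq_smul_add_smul_of_commute (h2 : (2 : k) ≠ 0) {e z : ℍ[k,a,b]}
    {d : k} (hd0 : d ≠ 0) (he : e.re = 0) (hd : e * e = algebraMap k _ d) (hze : z * e = e * z) :
    ∃ α β : k, z = α • 1 + β • e := by
  have him : z.im * e = e * z.im := by
    rw [← sub_re_self, sub_mul, mul_sub, hze, coe_commutes]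
  have hpure {w : ℍ[k,a,b]} (hw : w.re = 0) : star w = -w := by
    rw [star_eq_two_re_sub, hw, mul_zero, zero_mul, add_zero, QuaternionAlgebra.coe_zero, zero_sub]
  have hstar : star (z.im * e) = z.im * e := by
    rw [star_mul, hpure he, hpure (re_im z), neg_mul_neg, him]
  have hscalar : z.im * e = coe (z.im * e).re := by
    have h := self_add_star' (z.im * e)
    rw [hstar, zero_mul, add_zero, QuaternionAlgebra.coe_mul, coe_mul_eq_smul, ← two_smul k] at h
    exact smul_right_injective _ h2 h
  have hdim : d • z.im = (z.im * e).re • e := by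
    rw [← coe_mul_eq_smul, ← coe_mul_eq_smul, ← hscalar, mul_assoc, hd, coe_algebraMap,
      coe_commutes]
  refine ⟨z.re, d⁻¹ * (z.im * e).re, ?_⟩
  rw [mul_smul, ← hdim, inv_smul_smul₀ hd0]
  ext <;> simp

theorem quaternion_isCentral (h2 : (2 : k) ≠ 0) (ha : a ≠ 0) : Algebra.IsCentral k ℍ[k,a,b] where
  out z hz := by
    obtain ⟨α, β, rfl⟩ := quaternion_exists_eq_smul_add_smul_of_commute h2 ha
      (e := ⟨0, 1, 0, 0⟩) rfl (by ext <;> simp) (Subalgebra.mem_center_iff.mp hz _).symm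
    have hK : -β = β := by
      simpa using congrArg imK (Subalgebra.mem_center_iff.mp hz ⟨0, 0, 1, 0⟩)
    have hβ : β = 0 :=
      (mul_eq_zero.mp (show 2 * β = 0 by linear_combination -hK)).resolve_left h2
    rw [hβ, zero_smul, add_zero, Algebra.mem_bot]
    exact ⟨α, Algebra.algebraMap_eq_smul_one α⟩

theorem mul_commutator_eq_neg_commutator_mul {R : Type*} [Ring R] {x y : R}
    (h : Commute (x * x) y) : x * (x * y - y * x) = -((x * y - y * x) * x) := by
  rw [mul_sub, sub_mul, neg_sub, ← mul_assoc, h.eq, ← mul_assoc x y x, mul_assoc y x x]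

theorem quaternion_exists_anticommute [NoZeroDivisors ℍ[k,a,b]] {v : ℍ[k,a,b]}
    (hv : v * v = algebraMap k _ a) :
    ∃ u : ℍ[k,a,b], u ≠ 0 ∧ ⟨0, 1, 0, 0⟩ * u = -(u * ⟨0, 1, 0, 0⟩) ∧ v * u = -(u * v) := by
  set i : ℍ[k,a,b] := ⟨0, 1, 0, 0⟩
  have hi : i * i = algebraMap k _ a := by ext <;> simp [i]
  by_cases h : Commute i v
  · have hj : i * (⟨0, 0, 1, 0⟩ : ℍ[k,a,b]) = -(⟨0, 0, 1, 0⟩ * i) := by ext <;> simp [i]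
    refine ⟨⟨0, 0, 1, 0⟩, fun h0 => one_ne_zero (congrArg imJ h0), hj, ?_⟩
    rcases h.mul_self_eq_mul_self_iff.mp (hi.trans hv.symm) with hiv | hiv
    · rwa [← hiv]
    · rw [← neg_eq_iff_eq_neg.mpr hiv, neg_mul, mul_neg, hj]
  · refine ⟨i * v - v * i, sub_ne_zero.mpr h,
      mul_commutator_eq_neg_commutator_mul (hi ▸ Algebra.commutes a v), ?_⟩
    rw [← neg_sub, mul_neg, neg_mul,
      mul_commutator_eq_neg_commutator_mul (hv ▸ Algebra.commutes a i)]

theorem exists_sq_sub_mul_sq_eq_mul_of_algEquiv (h2 : (2 : k) ≠ 0) [NoZeroDivisors ℍ[k,a,c]]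
    (φ : ℍ[k,a,b] ≃ₐ[k] ℍ[k,a,c]) : ∃ x y : k, x ^ 2 - a * y ^ 2 = b * c := by
  have ha : a ≠ 0 := quaternion_left_ne_zero (b := c)
  have hi : (⟨0, 1, 0, 0⟩ : ℍ[k,a,b]) * ⟨0, 1, 0, 0⟩ = algebraMap k _ a := by ext <;> simp
  obtain ⟨u, hu0, hiu, hvu⟩ := quaternion_exists_anticommute (v := φ ⟨0, 1, 0, 0⟩)
    (by rw [← map_mul, hi, AlgEquiv.commutes])
  have huc := quaternion_mul_self_of_anticommute h2 ha hiu
  have hub := quaternion_mul_self_of_anticommute h2 ha (u := φ.symm u)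
    (φ.injective (by simpa using hvu))
  rw [← map_mul, huc, AlgEquiv.commutes] at hub
  replace hub := QuaternionAlgebra.algebraMap_injective hub
  set w := φ.symm u
  have hw : w.imJ ^ 2 - a * w.imK ^ 2 ≠ 0 := fun h0 => by
    rw [hub, h0, mul_zero, map_zero] at huc
    exact hu0 (mul_self_eq_zero.mp huc)
  refine ⟨c * (u.imJ * w.imJ + a * u.imK * w.imK) / (w.imJ ^ 2 - a * w.imK ^ 2),
    c * (u.imJ * w.imK + u.imK * w.imJ) / (w.imJ ^ 2 - a * w.imK ^ 2), ?_⟩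
  field_simp
  linear_combination c * (w.imJ ^ 2 - a * w.imK ^ 2) * hub

theorem quaternion_maximal_range_sqrtHom (h2 : (2 : k) ≠ 0) [NoZeroDivisors ℍ[k,a,b]]
    {e : ℍ[k,a,b]} {d : k} (he : e.re = 0) (hd : e * e = algebraMap k _ d) (hsq : ¬ IsSquare d) :
    Maximal (fun S : Subalgebra k ℍ[k,a,b] => IsField S) (sqrtHom hd).range := by
  refine ⟨isField_range_sqrtHom hd hsq, fun S hS hle z hz => ?_⟩
  have hd0 : d ≠ 0 := fun h0 => hsq (h0 ▸ IsSquare.zero)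
  have hze : z * e = e * z := congrArg Subtype.val
    (hS.mul_comm ⟨z, hz⟩ ⟨e, hle (self_mem_range_sqrtHom hd)⟩)
  exact (mem_range_sqrtHom hd).mpr
    (quaternion_exists_eq_smul_add_smul_of_commute h2 hd0 he hd hze)

theorem quaternion_not_isSquare_of_mul_self_eq [NoZeroDivisors ℍ[k,a,b]] {e : ℍ[k,a,b]} {d : k}
    (he : e.re = 0) (he0 : e ≠ 0) (hd : e * e = algebraMap k _ d) : ¬ IsSquare d := by
  refine not_isSquare_of_mul_self_eq_algebraMap (fun c hc => he0 ?_) hd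
  have hc0 : c = 0 := by simpa [hc] using he
  rw [hc, hc0, map_zero]

theorem quaternion_ne_bot_of_maximal [NoZeroDivisors ℍ[k,a,b]] {S : Subalgebra k ℍ[k,a,b]}
    (hS : Maximal (fun S : Subalgebra k ℍ[k,a,b] => IsField S) S) : S ≠ ⊥ := by
  rintro rfl
  have hi : (⟨0, 1, 0, 0⟩ : ℍ[k,a,b]) * ⟨0, 1, 0, 0⟩ = algebraMap k _ a := by ext <;> simp
  have hsq : ¬ IsSquare a :=
    quaternion_not_isSquare_of_mul_self_eq rfl (fun h0 => one_ne_zero (congrArg imI h0)) hi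
  obtain ⟨c, hc⟩ := Algebra.mem_bot.mp
    (hS.2 (isField_range_sqrtHom hi hsq) bot_le (self_mem_range_sqrtHom hi))
  exact zero_ne_one (congrArg imI hc)

theorem quaternion_exists_eq_range_sqrtHom (h2 : (2 : k) ≠ 0) [NoZeroDivisors ℍ[k,a,b]]
    {S : Subalgebra k ℍ[k,a,b]} (hS : Maximal (fun S : Subalgebra k ℍ[k,a,b] => IsField S) S) :
    ∃ (e : ℍ[k,a,b]) (d : k) (hd : e * e = algebraMap k _ d),
      ¬ IsSquare d ∧ S = (sqrtHom hd).range := by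
  obtain ⟨z, hzS, hz⟩ := SetLike.not_le_iff_exists.mp
    (mt le_bot_iff.mp (quaternion_ne_bot_of_maximal hS))
  have himS : z.im ∈ S := by
    rw [← sub_re_self]
    exact sub_mem hzS (algebraMap_mem S z.re)
  have him0 : z.im ≠ 0 := fun h0 => hz <| Algebra.mem_bot.mpr
    ⟨z.re, by rw [coe_algebraMap, ← re_add_im z, h0]; simp⟩
  have hd := quaternion_mul_self_of_re_eq_zero (z := z.im) rfl
  have hsq := quaternion_not_isSquare_of_mul_self_eq rfl him0 hd
  have hmax := quaternion_maximal_range_sqrtHom h2 rfl hd hsq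
  exact ⟨_, _, hd, hsq, (hmax.eq_of_le hS.1 (range_sqrtHom_le hd himS)).symm⟩

end Quaternion

namespace CentralDivisionAlgebra

open QuaternionAlgebra

variable {k : Type u} [Field k] {a b b' : k}

/-- The quaternion algebra `(a, b / k)`, where `k` has characteristic different from `2`, as a
central division algebra; that it is one is ensured by the absence of zero divisors. -/
noncomputable def ofQuaternion (h2 : (2 : k) ≠ 0) (a b : k) [NoZeroDivisors ℍ[k,a,b]] :
    CentralDivisionAlgebra k :=
  letI : DivisionRing ℍ[k,a,b] :=
    letI := NoZeroDivisors.to_isDomain ℍ[k,a,b]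
    divisionRingOfFiniteDimensional k ℍ[k,a,b]
  { carrier := ℍ[k,a,b]
    algebra := inferInstanceAs (Algebra k ℍ[k,a,b])
    isCentral := quaternion_isCentral h2 (quaternion_left_ne_zero (b := b))
    finiteDimensional := inferInstanceAs (Module.Finite k ℍ[k,a,b]) }

theorem isQuaternion_ofQuaternion (h2 : (2 : k) ≠ 0) [NoZeroDivisors ℍ[k,a,b]] :
    (ofQuaternion h2 a b).IsQuaternion :=
  ⟨a, b, quaternion_left_ne_zero (b := b), quaternion_right_ne_zero (a := a), ⟨AlgEquiv.refl⟩⟩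

theorem maximalSubfieldSpectrum_ofQuaternion_subset (h2 : (2 : k) ≠ 0)
    [NoZeroDivisors ℍ[k,a,b]] [NoZeroDivisors ℍ[k,a,b']]
    (hrep : ∀ d, IsSquare d ∨ ∃ x y z : k, d = a * x ^ 2 + b' * y ^ 2 - a * b' * z ^ 2) :
    (ofQuaternion h2 a b).maximalSubfieldSpectrum ⊆
      (ofQuaternion h2 a b').maximalSubfieldSpectrum := by
  rintro _ ⟨S, hS, rfl⟩
  obtain ⟨e, d, hd, hsq, rfl⟩ := quaternion_exists_eq_range_sqrtHom h2 hS
  obtain ⟨x, y, z, rfl⟩ := (hrep d).resolve_left hsq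
  have hd' := quaternion_mul_self_of_re_eq_zero (a := a) (b := b') (z := ⟨0, x, y, z⟩) rfl
  let ψ : (sqrtHom hd').range ≃ₐ[k] (sqrtHom hd).range :=
    (AlgEquiv.ofInjective _ (sqrtHom_injective hd' hsq)).symm.trans
      (AlgEquiv.ofInjective _ (sqrtHom_injective hd hsq))
  exact ⟨(sqrtHom hd').range, quaternion_maximal_range_sqrtHom h2 rfl hd' hsq, Quotient.sound ⟨ψ⟩⟩

theorem infinite_genus_ofQuaternion {ι : Type*} [Infinite ι] (h2 : (2 : k) ≠ 0) {b : ι → k}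
    [∀ i, NoZeroDivisors ℍ[k,a,b i]]
    (hrep : ∀ i d, IsSquare d ∨ ∃ x y z : k, d = a * x ^ 2 + b i * y ^ 2 - a * b i * z ^ 2)
    (hb : ∀ i j, i ≠ j → ∀ x y : k, x ^ 2 - a * y ^ 2 ≠ b i * b j) (i : ι) :
    (ofQuaternion h2 a (b i)).genus.Infinite := by
  refine Set.infinite_of_injective_forall_mem
    (f := fun j => (ofQuaternion h2 a (b j)).isoClass) (fun j l hjl => ?_) fun j => ?_
  · by_contra hne
    obtain ⟨φ⟩ := Quotient.exact hjl
    obtain ⟨x, y, hxy⟩ := exists_sq_sub_mul_sq_eq_mul_of_algEquiv h2 φ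
    exact hb j l hne x y hxy
  · exact ⟨_, Set.Subset.antisymm
      (maximalSubfieldSpectrum_ofQuaternion_subset h2 (hrep j))
      (maximalSubfieldSpectrum_ofQuaternion_subset h2 (hrep i)), rfl⟩

end CentralDivisionAlgebra

theorem padicValNat_mul_prime_eq_one {p q : ℕ} (hp : p.Prime) (hq : q.Prime) (hpq : p ≠ q) :
    padicValNat p (p * q) = 1 := by
  have : Fact p.Prime := ⟨hp⟩
  have : Fact q.Prime := ⟨hq⟩
  rw [padicValNat.mul hp.ne_zero hq.ne_zero, padicValNat_self, padicValNat_primes hpq]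

theorem infinite_setOf_prime_mod_four_eq_three : {p : ℕ | p.Prime ∧ p % 4 = 3}.Infinite := by
  refine (Nat.infinite_setOfPred_prime_and_eq_mod (q := 4) (a := 3) (by decide)).mono ?_
  exact fun p ⟨hp, h3⟩ => ⟨hp, (ZMod.natCast_eq_natCast_iff p 3 4).mp (by exact_mod_cast h3)⟩

theorem exists_subfield_real_forall_prime_not_sq_add_sq : ∃ K : Subfield ℝ,
    (∀ p : ℕ, p.Prime → p % 4 = 3 → ∀ x y : K, x ^ 2 + y ^ 2 ≠ p) ∧
    (∀ p q : ℕ, p.Prime → q.Prime → p % 4 = 3 → p ≠ q → ∀ x y : K, x ^ 2 + y ^ 2 ≠ p * q) ∧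
    ∀ b d : K, 0 < b → IsSquare d ∨ ∃ x y z : K, d = -x ^ 2 + b * y ^ 2 + b * z ^ 2 := by
  have : Countable (algebraMap ℚ ℝ).fieldRange :=
    (algebraMap ℚ ℝ).rangeRestrictField_bijective.surjective.countable
  obtain ⟨K, hK, hrep⟩ :=
    exists_subfield_real_forall_isSquare_or_represented (algebraMap ℚ ℝ).fieldRange
  have heven {n p : ℕ} (hp : p.Prime) (hp4 : p % 4 = 3) {x y : K} (hxy : x ^ 2 + y ^ 2 = n) :
      Even (padicValNat p n) := by
    obtain ⟨_, ⟨r, rfl⟩, _, ⟨s, rfl⟩, hrs⟩ :=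
      hK n (natCast_mem _ n) ⟨x, x.2, y, y.2, by exact_mod_cast congrArg Subtype.val hxy⟩
    exact even_padicValNat_of_rat_sq_add_sq_eq hp hp4
      ((algebraMap ℚ ℝ).injective (by simpa using hrs))
  refine ⟨K, fun p hp hp4 x y hxy => ?_, fun p q hp hq hp4 hpq x y hxy => ?_, hrep⟩
  · have : Fact p.Prime := ⟨hp⟩
    exact Nat.not_even_one (padicValNat_self (p := p) ▸ heven hp hp4 hxy)
  · rw [← Nat.cast_mul] at hxy
    exact Nat.not_even_one (padicValNat_mul_prime_eq_one hp hq hpq ▸ heven hp hp4 hxy)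

theorem theoremA :
    ∃ (K : Type) (_ : Field K) (_ : (2 : K) ≠ 0) (D : CentralDivisionAlgebra K),
      D.IsQuaternion ∧ D.genus.Infinite := by
  obtain ⟨K, hprime, hmul, hrep⟩ := exists_subfield_real_forall_prime_not_sq_add_sq
  let P := {p : ℕ // p.Prime ∧ p % 4 = 3}
  have : Infinite P := infinite_setOf_prime_mod_four_eq_three.to_subtype
  obtain ⟨p₀⟩ := Infinite.nonempty P
  have hdiv (p : P) : NoZeroDivisors ℍ[K,-1,(p : ℕ)] :=
    quaternion_noZeroDivisors (fun h => by linarith [h.nonneg]) fun x y hxy =>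
      hprime p p.2.1 p.2.2 x y (by linear_combination hxy)
  refine ⟨K, inferInstance, two_ne_zero, .ofQuaternion two_ne_zero (-1) (p₀ : ℕ),
    CentralDivisionAlgebra.isQuaternion_ofQuaternion _,
    CentralDivisionAlgebra.infinite_genus_ofQuaternion (b := fun p : P => ((p : ℕ) : K))
      two_ne_zero (fun p d => ?_) (fun p q hpq x y hxy => ?_) p₀⟩
  · refine (hrep (p : ℕ) d (by exact_mod_cast p.2.1.pos)).imp_right ?_
    exact fun ⟨x, y, z, h⟩ => ⟨x, y, z, by linear_combination h⟩
  · exact hmul p q p.2.1 q.2.1 p.2.2 (fun h => hpq (Subtype.ext h)) x y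
      (by linear_combination hxy)
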